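/- Let $M$ be a compact Hausdorff smooth manifold without boundary, with a Poisson structure, i.e. a smooth bivector field $p$ such that the bracket $\{f,g\}=p(df,dg)$ on $C^\infty(M)$ satisfies the Jacobi identity. Give $C^\infty(M)$ the $C^\infty$ topology (uniform convergence of all derivatives on compact subsets of charts); a generalized function (distribution) on $M$ is a continuous linear functional on $C_0^\infty(M)$ (which equals $C^\infty(M)$, as $M$ is compact). For $f\in C^\infty(M)$ and a distribution $\Phi$ define $\{f,\Phi\}$ by $\langle\{f,\Phi\},\psi\rangle=\langle\Phi,\{\psi,f\}\rangle$ for $\psi\in C_0^\infty(M)$, and let $\mathcal D_0(M)$ be the space of generalized Casimirs, i.e. of distributions $\Phi$ with $\{f,\Phi\}=0$ for every $f\in C^\infty(M)$. Let $\delta=i_p\circ d-d\circ i_p:\Omega^{n+1}(M)\to\Omega^{n}(M)$ be the differential of Brylinski's canonical complex, and let $H_0^{\mathrm{can}}(M)=C^\infty(M)/\delta(\Omega^1(M))$ be its homology in degree $0$, with the quotient topology. Then $\delta(\Omega^1(M))=\{C^\infty(M),C^\infty(M)\}$ (the linear span of all brackets), so $H_0^{\mathrm{can}}(M)=C^\infty(M)/\{C^\infty(M),C^\infty(M)\}$,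 and the spaces $\mathcal D_0(M)$ and $H_0^{\mathrm{can}}(M)^*$ (the continuous linear functionals on $H_0^{\mathrm{can}}(M)$) are isomorphic: there is a linear isomorphism $e:\mathcal D_0(M)\to H_0^{\mathrm{can}}(M)^*$ with $e(\Phi)([\psi])=\langle\Phi,\psi\rangle$ for all $\Phi\in\mathcal D_0(M)$ and $\psi\in C^\infty(M)$. -/

import Mathlib

open scoped Manifold ContDiff Topology

noncomputable section

namespace PoissonCasimir

section Manifold

variable (E : Type*) [NormedAddCommGroup E] [NormedSpace ℝ E]
  (M : Type*) [TopologicalSpace M] [ChartedSpace E M]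

/-- The algebra `C^∞(M)` of smooth real functions on a (boundaryless) manifold `M` modelled
on `E`. -/
abbrev Smooth : Type _ := C^∞⟮𝓘(ℝ, E), M; 𝓘(ℝ, ℝ), ℝ⟯

/-- The `C^∞` topology on `C^∞(M)`: uniform convergence, on the compact subsets of the charts,
of the coordinate expression together with each of its derivatives. -/
instance smoothTopology : TopologicalSpace (Smooth E M) :=
  ⨅ (x₀ : M) (k : ℕ), TopologicalSpace.induced
    (fun f : Smooth E M =>
      UniformOnFun.ofFun {K : Set E | IsCompact K ∧ K ⊆ (extChartAt 𝓘(ℝ, E) x₀).target}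
        (iteratedFDeriv ℝ k (fun y : E => f ((extChartAt 𝓘(ℝ, E) x₀).symm y))))
    inferInstance

/-- The space `C_0^∞(M)` of smooth functions with compact support. -/
def testFunctions : Submodule ℝ (Smooth E M) where
  carrier := {f | HasCompactSupport f}
  add_mem' := fun hf hg => HasCompactSupport.add hf hg
  zero_mem' := HasCompactSupport.zero
  smul_mem' := fun c f hf =>
    HasCompactSupport.smul_left (f := fun _ => c) (f' := (f : M → ℝ)) hf

/-- The space of generalized functions (distributions) on `M`: linear functionals on `C_0^∞(M)`
that are continuous, i.e. whose restriction to the functions supported in `K` is continuous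
for the `C^∞` topology, for each compact `K`. -/
def distributions : Submodule ℝ (testFunctions E M →ₗ[ℝ] ℝ) where
  carrier := {Φ | ∀ K : Set M, IsCompact K →
    ContinuousOn Φ {ψ : testFunctions E M | tsupport (ψ : Smooth E M) ⊆ K}}
  add_mem' := fun hΦ hΨ K hK => (hΦ K hK).add (hΨ K hK)
  zero_mem' := fun _ _ => continuousOn_const
  smul_mem' := fun c _ hΦ K hK => (hΦ K hK).const_smul c

variable {E M}

/-- The differential of a smooth function at a point, as a covector. -/
def covector (f : Smooth E M) (x : M) : TangentSpace 𝓘(ℝ, E) x →L[ℝ] ℝ :=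
  mfderiv 𝓘(ℝ, E) 𝓘(ℝ, ℝ) f x

variable (E M)

/-- A (not necessarily smooth) field of exterior `n`-forms on the tangent spaces of `M`. -/
abbrev FormField (n : ℕ) : Type _ :=
  (x : M) → (TangentSpace 𝓘(ℝ, E) x) [⋀^Fin n]→L[ℝ] ℝ

variable {E M}

/-- The coordinate expression of `α` in the chart at `x₀`: the pullback of `α` by the inverse
of the chart. -/
def inChart {n : ℕ} (α : FormField E M n) (x₀ : M) (y : E) : E [⋀^Fin n]→L[ℝ] ℝ :=
  (α ((extChartAt 𝓘(ℝ, E) x₀).symm y)).compContinuousLinearMap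
    (mfderiv 𝓘(ℝ, E) 𝓘(ℝ, E) (extChartAt 𝓘(ℝ, E) x₀).symm y)

/-- The exterior derivative: at `x`, the exterior derivative of the coordinate expression in the
chart at `x`, pulled back by that chart. -/
def exteriorD {n : ℕ} (α : FormField E M n) : FormField E M (n + 1) := fun x =>
  (extDeriv (inChart α x) (extChartAt 𝓘(ℝ, E) x x)).compContinuousLinearMap
    (mfderiv 𝓘(ℝ, E) 𝓘(ℝ, E) (extChartAt 𝓘(ℝ, E) x) x)

variable (E M)

/-- The space `Ω^n(M)` of smooth differential `n`-forms. -/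
def smoothForms (n : ℕ) : Submodule ℝ (FormField E M n) where
  carrier := {α | ∀ x₀ : M, ContDiffOn ℝ ∞ (inChart α x₀) (extChartAt 𝓘(ℝ, E) x₀).target}
  add_mem' := fun {α η} hα hη x₀ => by
    have h : inChart (α + η) x₀ = inChart α x₀ + inChart η x₀ := by
      ext y v; rfl
    rw [h]; exact (hα x₀).add (hη x₀)
  zero_mem' := fun x₀ => by
    have h : inChart (0 : FormField E M n) x₀ = fun _ => 0 := by
      ext y v; rfl
    rw [h]; exact contDiffOn_const
  smul_mem' := fun c α hα x₀ => by
    have h : inChart (c • α) x₀ = c • inChart α x₀ := by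
      ext y v; rfl
    rw [h]; exact (hα x₀).const_smul c

variable {E M}

theorem d_add {n : ℕ} {α β : FormField E M n} (hα : α ∈ smoothForms E M n)
    (hβ : β ∈ smoothForms E M n) : exteriorD (α + β) = exteriorD α + exteriorD β := by
  funext x
  have hx := extChartAt_target_mem_nhds (I := 𝓘(ℝ, E)) x
  have h1 := ((hα x).contDiffAt hx).differentiableAt (by simp)
  have h2 := ((hβ x).contDiffAt hx).differentiableAt (by simp)
  have h : inChart (α + β) x = inChart α x + inChart β x := by
    ext y v; rfl
  simp only [exteriorD, Pi.add_apply]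
  rw [h, extDeriv_add h1 h2]
  rfl

theorem d_smul {n : ℕ} (c : ℝ) (α : FormField E M n) : exteriorD (c • α) = c • exteriorD α := by
  funext x
  have h : inChart (c • α) x = c • inChart α x := by
    ext y v; rfl
  simp only [exteriorD, Pi.smul_apply]
  rw [h, extDeriv_smul]
  rfl

variable (E M)

/-- A field of bivectors on `M`; an element of `⋀² T_x M` is given as an alternating bilinear
form on the cotangent space. -/
abbrev BivectorField : Type _ :=
  (x : M) → (TangentSpace 𝓘(ℝ, E) x →L[ℝ] ℝ) [⋀^Fin 2]→ₗ[ℝ] ℝ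

variable {E M}

/-- The function `{f, g} = p(df, dg)`. -/
def BivectorField.bracketFun (p : BivectorField E M) (f g : Smooth E M) (x : M) : ℝ :=
  p x ![covector f x, covector g x]

variable (E M)

/-- A Poisson structure on `M`: a smooth bivector field `p` such that the bracket
`{f, g} = p(df, dg)` on `C^∞(M)` satisfies the Jacobi identity. Smoothness of `p` means that
`p(df, dg)` is smooth for all smooth `f`, `g`. -/
structure PoissonStructure where
  bivector : BivectorField E M
  smooth : ∀ f g : Smooth E M, ContMDiff 𝓘(ℝ, E) 𝓘(ℝ, ℝ) ∞ (bivector.bracketFun f g)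
  jacobi : ∀ f g h : Smooth E M, ∀ x : M,
    bivector.bracketFun f ⟨bivector.bracketFun g h, smooth g h⟩ x +
    bivector.bracketFun g ⟨bivector.bracketFun h f, smooth h f⟩ x +
    bivector.bracketFun h ⟨bivector.bracketFun f g, smooth f g⟩ x = 0

end Manifold

section Poisson

/-- Contraction of an exterior form with a bivector: if `p = ½ ∑ p(eⁱ, eʲ) e_i ∧ e_j`, then
`i_p η = ½ ∑ p(eⁱ, eʲ) η(e_i, e_j, …)`. The result does not depend on the basis. In particular
`i_p (α ∧ β) = p(α, β)` for covectors `α`, `β`. -/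
def contract {E : Type*} [NormedAddCommGroup E] [NormedSpace ℝ E] [FiniteDimensional ℝ E]
    {n : ℕ} (p : (E →L[ℝ] ℝ) [⋀^Fin 2]→ₗ[ℝ] ℝ) (η : E [⋀^Fin (n + 2)]→L[ℝ] ℝ) :
    E [⋀^Fin n]→L[ℝ] ℝ :=
  (1 / 2 : ℝ) • ∑ i, ∑ j,
    p ![((Module.finBasis ℝ E).coord i).toContinuousLinearMap,
        ((Module.finBasis ℝ E).coord j).toContinuousLinearMap] •
      ((η.curryLeft (Module.finBasis ℝ E i)).curryLeft (Module.finBasis ℝ E j))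

variable {E : Type*} [NormedAddCommGroup E] [NormedSpace ℝ E]
  {M : Type*} [TopologicalSpace M] [ChartedSpace E M]

namespace PoissonStructure

/-- The Poisson bracket of two smooth functions. -/
def bracket (P : PoissonStructure E M) (f g : Smooth E M) : Smooth E M :=
  ⟨P.bivector.bracketFun f g, P.smooth f g⟩

theorem covector_add [IsManifold 𝓘(ℝ, E) ∞ M] (f g : Smooth E M) (x : M) :
    covector (f + g) x = covector f x + covector g x := by
  have hf : MDifferentiableAt 𝓘(ℝ, E) 𝓘(ℝ, ℝ) f x := f.contMDiff.mdifferentiable (by simp) x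
  have hg : MDifferentiableAt 𝓘(ℝ, E) 𝓘(ℝ, ℝ) g x := g.contMDiff.mdifferentiable (by simp) x
  exact mfderiv_add hf hg

theorem covector_smul [IsManifold 𝓘(ℝ, E) ∞ M] (c : ℝ) (f : Smooth E M) (x : M) :
    covector (c • f) x = c • covector f x := by
  have hf : MDifferentiableAt 𝓘(ℝ, E) 𝓘(ℝ, ℝ) f x := f.contMDiff.mdifferentiable (by simp) x
  exact const_smul_mfderiv hf c

theorem covector_eq_zero (f : Smooth E M) (x : M) (hx : x ∉ tsupport f) : covector f x = 0 := by
  have h : (f : M → ℝ) =ᶠ[𝓝 x] fun _ => (0 : ℝ) := notMem_tsupport_iff_eventuallyEq.mp hx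
  have h2 : mfderiv 𝓘(ℝ, E) 𝓘(ℝ, ℝ) f x
      = mfderiv 𝓘(ℝ, E) 𝓘(ℝ, ℝ) (fun _ : M => (0 : ℝ)) x := h.mfderiv_eq
  exact h2.trans mfderiv_const

theorem bracket_add_left [IsManifold 𝓘(ℝ, E) ∞ M] (P : PoissonStructure E M)
    (f g h : Smooth E M) : P.bracket (f + g) h = P.bracket f h + P.bracket g h := by
  ext x
  change P.bivector x ![covector (f + g) x, covector h x]
    = P.bivector x ![covector f x, covector h x] + P.bivector x ![covector g x, covector h x]
  rw [covector_add]
  exact (P.bivector x).toMultilinearMap.cons_add ![covector h x] _ _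

theorem bracket_smul_left [IsManifold 𝓘(ℝ, E) ∞ M] (P : PoissonStructure E M)
    (c : ℝ) (f h : Smooth E M) : P.bracket (c • f) h = c • P.bracket f h := by
  ext x
  change P.bivector x ![covector (c • f) x, covector h x]
    = c * P.bivector x ![covector f x, covector h x]
  rw [covector_smul]
  exact (P.bivector x).toMultilinearMap.cons_smul ![covector h x] c _

theorem bracket_hasCompactSupport (P : PoissonStructure E M) (ψ f : Smooth E M)
    (hψ : HasCompactSupport ψ) : HasCompactSupport (P.bracket ψ f) := by
  refine hψ.mono' ?_
  intro x hx
  by_contra h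
  apply hx
  change P.bivector x ![covector ψ x, covector f x] = 0
  rw [covector_eq_zero ψ x h]
  exact (P.bivector x).toMultilinearMap.map_coord_zero 0 rfl

variable [IsManifold 𝓘(ℝ, E) ∞ M]

/-- The operator `ψ ↦ {ψ, f}` on compactly supported functions. -/
def bracketRight (P : PoissonStructure E M) (f : Smooth E M) :
    testFunctions E M →ₗ[ℝ] testFunctions E M where
  toFun ψ := ⟨P.bracket ψ f, P.bracket_hasCompactSupport ψ f ψ.2⟩
  map_add' ψ φ := Subtype.ext (P.bracket_add_left ψ φ f)
  map_smul' c ψ := Subtype.ext (P.bracket_smul_left c ψ f)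

/-- The Poisson bracket `{f, Φ} = X_f(Φ)` of a smooth function and a functional on `C_0^∞(M)`:
`⟨{f, Φ}, ψ⟩ = -⟨Φ, X_f(ψ)⟩ = ⟨Φ, {ψ, f}⟩`. -/
def bracketDistribution (P : PoissonStructure E M) (f : Smooth E M)
    (Φ : testFunctions E M →ₗ[ℝ] ℝ) : testFunctions E M →ₗ[ℝ] ℝ :=
  Φ ∘ₗ P.bracketRight f

/-- The space of generalized Casimir functions: the distributions `Φ` with `{f, Φ} = 0` for every
smooth function `f`. -/
def generalizedCasimirs (P : PoissonStructure E M) : Submodule ℝ (distributions E M) where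
  carrier := {Φ | ∀ f : Smooth E M, P.bracketDistribution f Φ = 0}
  add_mem' := fun {Φ Ψ} hΦ hΨ f => by
    have h : P.bracketDistribution f ((Φ + Ψ : distributions E M) : testFunctions E M →ₗ[ℝ] ℝ)
      = P.bracketDistribution f Φ + P.bracketDistribution f Ψ := rfl
    rw [h, hΦ f, hΨ f, add_zero]
  zero_mem' := fun _ => rfl
  smul_mem' := fun c Φ hΦ f => by
    have h : P.bracketDistribution f ((c • Φ : distributions E M) : testFunctions E M →ₗ[ℝ] ℝ)
      = c • P.bracketDistribution f Φ := rfl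
    rw [h, hΦ f, smul_zero]

variable [FiniteDimensional ℝ E]

/-- Contraction `i_p : Ω^{n+2} → Ω^n` with the Poisson bivector. -/
def interior (P : PoissonStructure E M) {n : ℕ} (α : FormField E M (n + 2)) : FormField E M n :=
  fun x => contract (E := E) (P.bivector x) (α x)

/-- The differential `δ = i_p ∘ d - d ∘ i_p : Ω^{n+1} → Ω^n` of the canonical complex; on `1`-forms
`i_p` vanishes for degree reasons. -/
def canonicalDifferential (P : PoissonStructure E M) :
    (n : ℕ) → FormField E M (n + 1) → FormField E M n
  | 0, α => P.interior (exteriorD α)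
  | _ + 1, α => P.interior (exteriorD α) - exteriorD (P.interior α)

theorem contract_add {n : ℕ} (p : (E →L[ℝ] ℝ) [⋀^Fin 2]→ₗ[ℝ] ℝ)
    (η θ : E [⋀^Fin (n + 2)]→L[ℝ] ℝ) : contract p (η + θ) = contract p η + contract p θ := by
  simp only [contract, ContinuousAlternatingMap.curryLeft_add, add_apply,
    smul_add, Finset.sum_add_distrib]

theorem contract_smul {n : ℕ} (p : (E →L[ℝ] ℝ) [⋀^Fin 2]→ₗ[ℝ] ℝ) (c : ℝ)
    (η : E [⋀^Fin (n + 2)]→L[ℝ] ℝ) : contract p (c • η) = c • contract p η := by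
  simp only [contract, ContinuousAlternatingMap.curryLeft_smul, smul_apply,
    Finset.smul_sum]
  simp only [smul_comm c]

theorem canonicalDifferential_zero_add (P : PoissonStructure E M) {α β : FormField E M 1}
    (hα : α ∈ smoothForms E M 1) (hβ : β ∈ smoothForms E M 1) :
    P.canonicalDifferential 0 (α + β)
      = P.canonicalDifferential 0 α + P.canonicalDifferential 0 β := by
  funext x
  change contract (E := E) (P.bivector x) (exteriorD (α + β) x) = _
  rw [d_add hα hβ]
  exact contract_add _ _ _

theorem canonicalDifferential_zero_smul (P : PoissonStructure E M) (c : ℝ) (α : FormField E M 1) :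
    P.canonicalDifferential 0 (c • α) = c • P.canonicalDifferential 0 α := by
  funext x
  change contract (E := E) (P.bivector x) (exteriorD (c • α) x) = _
  rw [d_smul c α]
  exact contract_smul _ _ _

/-- The space `δ(Ω¹(M))` of boundaries in degree `0`, where `Ω⁰(M)` is identified with `C^∞(M)`
(a `0`-form is a function with values in the forms of no arguments). -/
def boundaries (P : PoissonStructure E M) : Submodule ℝ (Smooth E M) where
  carrier := {f | ∃ α ∈ smoothForms E M 1, ∀ x, f x = P.canonicalDifferential 0 α x ![]}
  add_mem' := by
    rintro f g ⟨α, hα, hf⟩ ⟨β, hβ, hg⟩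
    refine ⟨α + β, (smoothForms E M 1).add_mem hα hβ, fun x => ?_⟩
    change f x + g x = _
    rw [hf x, hg x, canonicalDifferential_zero_add P hα hβ]
    rfl
  zero_mem' := by
    refine ⟨(0 : ℝ) • 0, by simp, fun x => ?_⟩
    rw [canonicalDifferential_zero_smul]
    simp
  smul_mem' := by
    rintro c f ⟨α, hα, hf⟩
    refine ⟨c • α, (smoothForms E M 1).smul_mem c hα, fun x => ?_⟩
    change c * f x = _
    rw [hf x, canonicalDifferential_zero_smul]
    rfl

/-- The homology `H_0^can(M) = C^∞(M) / δ(Ω¹(M))` of the canonical complex in degree `0` (every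
`0`-form is a cycle), with the quotient topology. -/
abbrev H0 (P : PoissonStructure E M) : Type _ := Smooth E M ⧸ P.boundaries

end PoissonStructure

end Poisson

end PoissonCasimir

end

/-! On forms `f dg` one has `δ(f dg) = i_p(df ∧ dg) = {f, g}`
(`canonicalDifferential_mulDifferential`), so every bracket is a boundary. Conversely, a partition
of unity subordinate to charts writes any smooth `1`-form on a compact manifold as a finite sum of
forms `f dg` (`mem_span_mulDifferential`), so every boundary is a combination of brackets. This
gives `boundaries_eq_span_bracket`.

The duality is then formal. A distribution is a generalized Casimir exactly when it kills all `{ψ,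
f}`, that is, all boundaries. As `M` is compact, test functions are all smooth functions and
distributions are globally continuous, so Casimirs are the continuous functionals on `C^∞(M)` that
factor through the quotient. The quotient topology makes the factored map continuous, whether or not
the boundaries are closed. -/

open scoped Manifold ContDiff Topology

noncomputable section

namespace PoissonCasimir

/-! ### The forms `f dg` and their exterior derivative. -/

section Forms

variable {E : Type*} [NormedAddCommGroup E] [NormedSpace ℝ E]
  {M : Type*} [TopologicalSpace M] [ChartedSpace E M]

/-- The `1`-form `f dg`. -/
def mulDifferential (f g : Smooth E M) : FormField E M 1 := fun x =>
  f x • ContinuousAlternatingMap.ofSubsingleton ℝ (TangentSpace 𝓘(ℝ, E) x) ℝ (0 : Fin 1)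
    (covector g x)

theorem extChartAt_symm_mdifferentiableAt [IsManifold 𝓘(ℝ, E) ∞ M] (x₀ : M) {y : E}
    (hy : y ∈ (extChartAt 𝓘(ℝ, E) x₀).target) :
    MDifferentiableAt 𝓘(ℝ, E) 𝓘(ℝ, E) (extChartAt 𝓘(ℝ, E) x₀).symm y :=
  ((contMDiffOn_extChartAt_symm (n := ∞) x₀).contMDiffAt
    ((isOpen_extChartAt_target x₀).mem_nhds hy)).mdifferentiableAt (by simp)

theorem extChartAt_mdifferentiableAt [IsManifold 𝓘(ℝ, E) ∞ M] (x₀ : M) {x : M}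
    (hx : x ∈ (extChartAt 𝓘(ℝ, E) x₀).source) :
    MDifferentiableAt 𝓘(ℝ, E) 𝓘(ℝ, E) (extChartAt 𝓘(ℝ, E) x₀) x :=
  (contMDiffAt_extChartAt' (n := ∞) (by simpa using hx)).mdifferentiableAt (by simp)

theorem Smooth.mdifferentiableAt (f : Smooth E M) (x : M) :
    MDifferentiableAt 𝓘(ℝ, E) 𝓘(ℝ, ℝ) f x :=
  f.contMDiff.mdifferentiable (by simp) x

theorem Smooth.contDiffOn_symm [IsManifold 𝓘(ℝ, E) ∞ M] (f : Smooth E M) (x₀ : M) :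
    ContDiffOn ℝ ∞ (f ∘ (extChartAt 𝓘(ℝ, E) x₀).symm) (extChartAt 𝓘(ℝ, E) x₀).target :=
  contMDiffOn_iff_contDiffOn.1 (f.contMDiff.comp_contMDiffOn (contMDiffOn_extChartAt_symm x₀))

theorem Smooth.fderiv_symm [IsManifold 𝓘(ℝ, E) ∞ M] (f : Smooth E M) (x₀ : M) {y : E}
    (hy : y ∈ (extChartAt 𝓘(ℝ, E) x₀).target) (v : E) :
    fderiv ℝ (f ∘ (extChartAt 𝓘(ℝ, E) x₀).symm) y v
      = covector f ((extChartAt 𝓘(ℝ, E) x₀).symm y)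
        (mfderiv 𝓘(ℝ, E) 𝓘(ℝ, E) (extChartAt 𝓘(ℝ, E) x₀).symm y v) := by
  rw [← mfderiv_eq_fderiv]
  exact mfderiv_comp_apply y (f.mdifferentiableAt _) (extChartAt_symm_mdifferentiableAt x₀ hy) v

theorem Smooth.fderiv_symm_mfderiv [IsManifold 𝓘(ℝ, E) ∞ M] (f : Smooth E M) (x : M)
    (v : TangentSpace 𝓘(ℝ, E) x) :
    fderiv ℝ (f ∘ (extChartAt 𝓘(ℝ, E) x).symm) (extChartAt 𝓘(ℝ, E) x x)
      (mfderiv 𝓘(ℝ, E) 𝓘(ℝ, E) (extChartAt 𝓘(ℝ, E) x) x v) = covector f x v := by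
  have hx := mem_extChartAt_source (I := 𝓘(ℝ, E)) x
  have h1 : MDifferentiableAt 𝓘(ℝ, E) 𝓘(ℝ, ℝ) (f ∘ (extChartAt 𝓘(ℝ, E) x).symm)
      (extChartAt 𝓘(ℝ, E) x x) :=
    (f.mdifferentiableAt _).comp _
      (extChartAt_symm_mdifferentiableAt x (mem_extChartAt_target x))
  rw [← mfderiv_eq_fderiv]
  refine (mfderiv_comp_apply x h1 (extChartAt_mdifferentiableAt x hx) v).symm.trans ?_
  have h2 : (f ∘ (extChartAt 𝓘(ℝ, E) x).symm) ∘ extChartAt 𝓘(ℝ, E) x =ᶠ[𝓝 x] f := by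
    filter_upwards [extChartAt_source_mem_nhds (I := 𝓘(ℝ, E)) x] with z hz
    exact congrArg f ((extChartAt 𝓘(ℝ, E) x).left_inv hz)
  exact congrArg (fun L : E →L[ℝ] ℝ => L v) h2.mfderiv_eq

/-- The coordinate expression of `f dg`. -/
theorem inChart_mulDifferential [IsManifold 𝓘(ℝ, E) ∞ M] (f g : Smooth E M) (x₀ : M) {y : E}
    (hy : y ∈ (extChartAt 𝓘(ℝ, E) x₀).target) :
    inChart (mulDifferential f g) x₀ y = (f ∘ (extChartAt 𝓘(ℝ, E) x₀).symm) y •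
      ContinuousAlternatingMap.ofSubsingletonLIE (𝕜 := ℝ) (E := E) (F := ℝ) (0 : Fin 1)
        (fderiv ℝ (g ∘ (extChartAt 𝓘(ℝ, E) x₀).symm) y) := by
  ext v
  exact congrArg (f ((extChartAt 𝓘(ℝ, E) x₀).symm y) * ·) (g.fderiv_symm x₀ hy (v 0)).symm

theorem contDiffOn_mul_fderiv {F G : E → ℝ} {s : Set E} (hs : IsOpen s) (hF : ContDiffOn ℝ ∞ F s)
    (hG : ContDiffOn ℝ ∞ G s) :
    ContDiffOn ℝ ∞ (fun y => F y •
      ContinuousAlternatingMap.ofSubsingletonLIE (𝕜 := ℝ) (E := E) (F := ℝ) (0 : Fin 1) (fderiv ℝ G y)) s :=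
  hF.smul ((ContinuousAlternatingMap.ofSubsingletonLIE (𝕜 := ℝ) (E := E) (F := ℝ) (0 : Fin 1)).contDiff.comp_contDiffOn
    (hG.fderiv_of_isOpen hs (by simp)))

theorem mulDifferential_mem_smoothForms [IsManifold 𝓘(ℝ, E) ∞ M] (f g : Smooth E M) :
    mulDifferential f g ∈ smoothForms E M 1 := fun x₀ =>
  (contDiffOn_mul_fderiv (isOpen_extChartAt_target x₀) (f.contDiffOn_symm x₀)
    (g.contDiffOn_symm x₀)).congr fun _ hy => inChart_mulDifferential f g x₀ hy

/-- This is `d(F dG) = dF ∧ dG`: by the product rule the remaining term is `F` times the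
antisymmetrized second derivative of `G`, which vanishes by symmetry. -/
theorem extDeriv_mul_fderiv {F G : E → ℝ} {y : E} (hF : ContDiffAt ℝ ∞ F y)
    (hG : ContDiffAt ℝ ∞ G y) (u v : E) :
    extDeriv (fun y => F y •
      ContinuousAlternatingMap.ofSubsingletonLIE (𝕜 := ℝ) (E := E) (F := ℝ) (0 : Fin 1) (fderiv ℝ G y)) y ![u, v]
      = fderiv ℝ F y u * fderiv ℝ G y v - fderiv ℝ F y v * fderiv ℝ G y u := by
  have hF' : DifferentiableAt ℝ F y := hF.differentiableAt (by simp)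
  have h2 : (1 + 1 : WithTop ℕ∞) ≤ ∞ := by
    rw [one_add_one_eq_two]
    exact WithTop.coe_le_coe.2 (le_top : (2 : ℕ∞) ≤ ⊤)
  have hG' : DifferentiableAt ℝ (fderiv ℝ G) y :=
    ((hG.of_le h2).fderiv_right (m := 1) le_rfl).differentiableAt one_ne_zero
  have hsymm : IsSymmSndFDerivAt ℝ G y := hG.isSymmSndFDerivAt (by
    rwa [minSmoothness_of_isRCLikeNormedField, ← one_add_one_eq_two])
  have hL : HasFDerivAt (fun y =>
      ContinuousAlternatingMap.ofSubsingletonLIE (𝕜 := ℝ) (E := E) (F := ℝ) (0 : Fin 1) (fderiv ℝ G y)) _ y :=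
    (ContinuousAlternatingMap.ofSubsingletonLIE (𝕜 := ℝ) (E := E) (F := ℝ)
      (0 : Fin 1)).toContinuousLinearEquiv.toContinuousLinearMap.hasFDerivAt.comp y hG'.hasFDerivAt
  have h := hF'.hasFDerivAt.fun_smul hL
  rw [extDeriv, h.fderiv, ContinuousAlternatingMap.alternatizeUncurryFin_apply]
  simp [Fin.sum_univ_two, Fin.removeNth, hsymm.eq u v]
  ring

theorem exteriorD_mulDifferential [IsManifold 𝓘(ℝ, E) ∞ M] (f g : Smooth E M) (x : M)
    (u v : TangentSpace 𝓘(ℝ, E) x) :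
    exteriorD (mulDifferential f g) x ![u, v]
      = covector f x u * covector g x v - covector f x v * covector g x u := by
  have ht := extChartAt_target_mem_nhds (I := 𝓘(ℝ, E)) x
  have h : inChart (mulDifferential f g) x =ᶠ[𝓝 (extChartAt 𝓘(ℝ, E) x x)] _ :=
    Filter.eventuallyEq_of_mem ht fun y hy => inChart_mulDifferential f g x hy
  change extDeriv (inChart (mulDifferential f g) x) (extChartAt 𝓘(ℝ, E) x x)
    (mfderiv 𝓘(ℝ, E) 𝓘(ℝ, E) (extChartAt 𝓘(ℝ, E) x) x ∘ ![u, v]) = _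
  rw [h.extDeriv_eq]
  have e := extDeriv_mul_fderiv ((f.contDiffOn_symm x).contDiffAt ht)
    ((g.contDiffOn_symm x).contDiffAt ht)
    (mfderiv 𝓘(ℝ, E) 𝓘(ℝ, E) (extChartAt 𝓘(ℝ, E) x) x u)
    (mfderiv 𝓘(ℝ, E) 𝓘(ℝ, E) (extChartAt 𝓘(ℝ, E) x) x v)
  simp only [Smooth.fderiv_symm_mfderiv] at e
  rw [← e]
  congr 1
  ext i
  fin_cases i <;> rfl

/-- The compact set in the definition of a distribution may be taken to be all of `M`. -/
theorem continuous_distribution [CompactSpace M] (Φ : distributions E M) :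
    Continuous (Φ : testFunctions E M →ₗ[ℝ] ℝ) := by
  rw [← continuousOn_univ]
  exact (Φ.2 Set.univ isCompact_univ).mono fun _ _ => Set.subset_univ _

end Forms

/-! ### Linear algebra of bivectors and contraction. -/

section Contraction

variable {E : Type*} [NormedAddCommGroup E] [NormedSpace ℝ E]

theorem bivector_swap (p : (E →L[ℝ] ℝ) [⋀^Fin 2]→ₗ[ℝ] ℝ) (a b : E →L[ℝ] ℝ) :
    p ![a, b] = -p ![b, a] := by
  rw [← p.map_swap ![b, a] (i := 0) (j := 1) (by simp)]
  congr 1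
  ext i
  fin_cases i <;> rfl

variable [FiniteDimensional ℝ E]

theorem sum_coord_smul (a : E →L[ℝ] ℝ) :
    ∑ i, a (Module.finBasis ℝ E i) • ((Module.finBasis ℝ E).coord i).toContinuousLinearMap = a := by
  ext v
  conv_rhs => rw [← (Module.finBasis ℝ E).sum_repr v, map_sum]
  simp [-Module.Basis.sum_repr, mul_comm]

/-- A bivector is determined by its coefficients in a basis. -/
theorem bivector_eq_sum (p : (E →L[ℝ] ℝ) [⋀^Fin 2]→ₗ[ℝ] ℝ) (a b : E →L[ℝ] ℝ) :
    p ![a, b] = ∑ i, ∑ j, a (Module.finBasis ℝ E i) * b (Module.finBasis ℝ E j) *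
      p ![((Module.finBasis ℝ E).coord i).toContinuousLinearMap,
        ((Module.finBasis ℝ E).coord j).toContinuousLinearMap] := by
  let B : (E →L[ℝ] ℝ) →ₗ[ℝ] (E →L[ℝ] ℝ) →ₗ[ℝ] ℝ := LinearMap.mk₂ ℝ (fun a b => p ![a, b])
    (fun a a' b => p.toMultilinearMap.cons_add ![b] a a')
    (fun c a b => p.toMultilinearMap.cons_smul ![b] c a)
    -- Linearity in the second slot is reduced to the first by antisymmetry.
    (fun a b b' => by
      have h : p ![b + b', a] = _ := p.toMultilinearMap.cons_add ![a] b b'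
      rw [bivector_swap p a, bivector_swap p a, bivector_swap p a, h]
      exact neg_add _ _)
    (fun c a b => by
      have h : p ![c • b, a] = _ := p.toMultilinearMap.cons_smul ![a] c b
      rw [bivector_swap p a, bivector_swap p a, h]
      exact (smul_neg c _).symm)
  have h : B a b = B (∑ i, a (Module.finBasis ℝ E i) •
      ((Module.finBasis ℝ E).coord i).toContinuousLinearMap) (∑ j, b (Module.finBasis ℝ E j) •
      ((Module.finBasis ℝ E).coord j).toContinuousLinearMap) := by
    rw [sum_coord_smul, sum_coord_smul]
  simp only [map_sum, map_smul, LinearMap.sum_apply, LinearMap.smul_apply, smul_eq_mul] at h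
  change B a b = _
  rw [h]
  simp only [Finset.mul_sum]
  rw [Finset.sum_comm]
  refine Finset.sum_congr rfl fun i _ => Finset.sum_congr rfl fun j _ => ?_
  rw [← mul_assoc, mul_comm (b _)]
  rfl

/-- Expanding in the basis gives half of `p(a, b) - p(b, a)`; antisymmetry of `p` absorbs the factor
`1 / 2`. -/
theorem contract_wedge (p : (E →L[ℝ] ℝ) [⋀^Fin 2]→ₗ[ℝ] ℝ) (a b : E →L[ℝ] ℝ)
    (η : E [⋀^Fin 2]→L[ℝ] ℝ) (h : ∀ u v, η ![u, v] = a u * b v - a v * b u) :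
    contract (n := 0) p η ![] = p ![a, b] := by
  have hη : contract (n := 0) p η ![] = 1 / 2 * (p ![a, b] - p ![b, a]) := by
    rw [bivector_eq_sum p a b, bivector_eq_sum p b a, ← Finset.sum_sub_distrib]
    simp only [← Finset.sum_sub_distrib]
    simp only [contract, ContinuousAlternatingMap.smul_apply, ContinuousAlternatingMap.sum_apply, smul_eq_mul]
    congr 1
    refine Finset.sum_congr rfl fun i _ => Finset.sum_congr rfl fun j _ => ?_
    change _ * η ![_, _] = _
    rw [h]
    ring
  rw [hη, bivector_swap p b a]
  ring

end Contraction

/-! ### Decomposition of smooth `1`-forms into sums of `f dg`. -/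

section Decomposition

variable {E : Type*} [NormedAddCommGroup E] [NormedSpace ℝ E]
  {M : Type*} [TopologicalSpace M] [ChartedSpace E M] [IsManifold 𝓘(ℝ, E) ∞ M]

/-- Extension by zero: smoothness need only be checked on the support of the product, which lies in
the chart domain. -/
theorem exists_smooth_mul_eq {ρ : Smooth E M} {c : M}
    (hρ : tsupport ρ ⊆ (chartAt E c).source) {a : E → ℝ}
    (ha : ContDiffOn ℝ ∞ a (extChartAt 𝓘(ℝ, E) c).target) :
    ∃ f : Smooth E M, ∀ x, f x = ρ x * a (extChartAt 𝓘(ℝ, E) c x) := by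
  refine ⟨⟨fun x => ρ x * a (extChartAt 𝓘(ℝ, E) c x), ?_⟩, fun _ => rfl⟩
  refine contMDiff_of_tsupport fun x hx => ?_
  have hx' : x ∈ (chartAt E c).source := hρ (tsupport_mul_subset_left hx)
  have hxs : x ∈ (extChartAt 𝓘(ℝ, E) c).source := by simpa using hx'
  have h1 : ContDiffAt ℝ ∞ a (extChartAt 𝓘(ℝ, E) c x) :=
    ha.contDiffAt ((isOpen_extChartAt_target c).mem_nhds ((extChartAt 𝓘(ℝ, E) c).map_source hxs))
  exact ρ.contMDiff.contMDiffAt.mul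
    (h1.contMDiffAt.comp x (contMDiffAt_extChartAt' hx'))

/-- On the source of a chart, a form is the pullback of its coordinate expression. -/
theorem inChart_mfderiv {n : ℕ} (α : FormField E M n) {c x : M}
    (hx : x ∈ (extChartAt 𝓘(ℝ, E) c).source) (v : Fin n → TangentSpace 𝓘(ℝ, E) x) :
    inChart α c (extChartAt 𝓘(ℝ, E) c x)
      (fun i => mfderiv 𝓘(ℝ, E) 𝓘(ℝ, E) (extChartAt 𝓘(ℝ, E) c) x (v i)) = α x v := by
  have h : ∀ w : TangentSpace 𝓘(ℝ, E) x,
      mfderiv 𝓘(ℝ, E) 𝓘(ℝ, E) (extChartAt 𝓘(ℝ, E) c).symm (extChartAt 𝓘(ℝ, E) c x)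
        (mfderiv 𝓘(ℝ, E) 𝓘(ℝ, E) (extChartAt 𝓘(ℝ, E) c) x w) = w := fun w => by
    have hs := extChartAt_symm_mdifferentiableAt c ((extChartAt 𝓘(ℝ, E) c).map_source hx)
    refine (mfderiv_comp_apply x hs (extChartAt_mdifferentiableAt c hx) w).symm.trans ?_
    have h2 : (extChartAt 𝓘(ℝ, E) c).symm ∘ extChartAt 𝓘(ℝ, E) c =ᶠ[𝓝 x] id := by
      filter_upwards [extChartAt_source_mem_nhds' hx] with z hz
      exact (extChartAt 𝓘(ℝ, E) c).left_inv hz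
    have h3 := h2.mfderiv_eq (I := 𝓘(ℝ, E)) (I' := 𝓘(ℝ, E))
    rw [mfderiv_id] at h3
    exact congrArg (fun L : E →L[ℝ] E => L w) h3
  -- The type of `α z` depends on `z`, so the base point is generalized and the equality `z = x`
  -- eliminated by substitution.
  have key : ∀ (z : M) (hz : z = x) (L : E →L[ℝ] E) (w : Fin n → E), (∀ i, L (w i) = v i) →
      (show E [⋀^Fin n]→L[ℝ] ℝ from α z) (fun i => L (w i)) = α x v := by
    rintro z rfl L w hw
    exact congrArg (α z) (funext hw)
  exact key _ ((extChartAt 𝓘(ℝ, E) c).left_inv hx) _ _ fun i => h (v i)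

variable [FiniteDimensional ℝ E]

/-- A smooth `1`-form times a function supported where the bump function `χ` of a chart is
locally `1` is a combination of forms `f dg`. -/
theorem smul_mem_span_mulDifferential [T2Space M] {α : FormField E M 1}
    (hα : α ∈ smoothForms E M 1) (ρ : Smooth E M) {c : M} (χ : SmoothBumpFunction 𝓘(ℝ, E) c)
    (hρ : tsupport ρ ⊆ interior {x | χ x = 1}) :
    (fun x => ρ x • α x : FormField E M 1) ∈
      Submodule.span ℝ {β : FormField E M 1 | ∃ f g, β = mulDifferential f g} := by
  have hsub : interior {x | χ x = 1} ⊆ (chartAt E c).source := fun x hx =>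
    χ.support_subset_source (by
      rw [Function.mem_support, show χ x = 1 from interior_subset (s := {x | χ x = 1}) hx]
      exact one_ne_zero)
  let b := Module.finBasis ℝ E
  -- The `f j` are the components of `α` in the chart, cut off by `ρ`; the `g j` below are the
  -- coordinates, cut off by `χ`.
  have hf : ∀ j, ∃ f : Smooth E M, ∀ x, f x =
      ρ x * inChart α c (extChartAt 𝓘(ℝ, E) c x) (fun _ => b j) := fun j =>
    exists_smooth_mul_eq (hρ.trans hsub) (a := fun y => inChart α c y fun _ => b j)
      ((ContinuousAlternatingMap.apply ℝ E ℝ (fun _ : Fin 1 => b j)).contDiff.comp_contDiffOn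
        (hα c))
  have hg : ∀ j, ∃ g : Smooth E M, ∀ x, g x = χ x * b.coord j (extChartAt 𝓘(ℝ, E) c x) := fun j =>
    exists_smooth_mul_eq (ρ := ⟨χ, χ.contMDiff⟩) χ.tsupport_subset_chartAt_source
      (a := b.coord j) (b.coord j).toContinuousLinearMap.contDiff.contDiffOn
  choose f hf using hf
  choose g hg using hg
  have : (fun x => ρ x • α x : FormField E M 1) = ∑ j, mulDifferential (f j) (g j) := by
    funext x
    rw [Finset.sum_apply]
    -- Where `χ` is locally `1`, the `d(g j)` are the coordinate covectors and the sum is the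
    -- expansion of `ρ α`; elsewhere `ρ` vanishes and so do both sides.
    by_cases hx : x ∈ interior {x | χ x = 1}
    · have hxs : x ∈ (extChartAt 𝓘(ℝ, E) c).source := by simpa using hsub hx
      have hcov : ∀ j (v : TangentSpace 𝓘(ℝ, E) x), covector (g j) x v =
          b.coord j (mfderiv 𝓘(ℝ, E) 𝓘(ℝ, E) (extChartAt 𝓘(ℝ, E) c) x v) := fun j v => by
        have h1 : (g j : M → ℝ) =ᶠ[𝓝 x]
            (b.coord j).toContinuousLinearMap ∘ extChartAt 𝓘(ℝ, E) c := by
          filter_upwards [isOpen_interior.mem_nhds hx] with z hz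
          rw [hg, show χ z = 1 from interior_subset (s := {x | χ x = 1}) hz, one_mul]
          rfl
        have h2 := h1.mfderiv_eq (I := 𝓘(ℝ, E)) (I' := 𝓘(ℝ, ℝ))
        refine (congrArg (fun L : E →L[ℝ] ℝ => L v) h2).trans ?_
        refine (mfderiv_comp_apply x
          (b.coord j).toContinuousLinearMap.differentiableAt.mdifferentiableAt
          (extChartAt_mdifferentiableAt c hxs) v).trans ?_
        rw [mfderiv_eq_fderiv, ContinuousLinearMap.fderiv]
        rfl
      ext v
      rw [ContinuousAlternatingMap.sum_apply]
      change ρ x * α x v = ∑ j, f j x * covector (g j) x (v 0)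
      simp only [hf, hcov]
      rw [← inChart_mfderiv α hxs]
      set w : E := mfderiv 𝓘(ℝ, E) 𝓘(ℝ, E) (extChartAt 𝓘(ℝ, E) c) x (v 0)
      let A : E →L[ℝ] ℝ := (ContinuousAlternatingMap.ofSubsingleton ℝ E ℝ (0 : Fin 1)).symm
        (inChart α c (extChartAt 𝓘(ℝ, E) c x))
      have hA : ∀ u : Fin 1 → E, inChart α c (extChartAt 𝓘(ℝ, E) c x) u = A (u 0) := fun u =>
        congrArg _ (funext fun i => by rw [Subsingleton.elim i 0])
      have hsum : A w = ∑ j, b.coord j w * A (b j) := by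
        conv_lhs => rw [← b.sum_repr w, map_sum]
        simp [-Module.Basis.sum_repr]
      refine (congrArg (ρ x * ·) (hA _)).trans ?_
      change ρ x * A w = _
      simp only [hA]
      rw [hsum, Finset.mul_sum]
      exact Finset.sum_congr rfl fun j _ => by ring
    · have hρx : ρ x = 0 := image_eq_zero_of_notMem_tsupport fun h => hx (hρ h)
      rw [hρx, zero_smul]
      refine (Finset.sum_eq_zero fun j _ => ?_).symm
      rw [mulDifferential, hf, hρx, zero_mul, zero_smul]
  rw [this]
  exact Submodule.sum_mem _ fun j _ => Submodule.subset_span ⟨_, _, rfl⟩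

/-- On a compact manifold, every smooth `1`-form is a finite sum of forms `f dg`. -/
theorem mem_span_mulDifferential [T2Space M] [CompactSpace M] {α : FormField E M 1}
    (hα : α ∈ smoothForms E M 1) :
    α ∈ Submodule.span ℝ {β : FormField E M 1 | ∃ f g, β = mulDifferential f g} := by
  let χ : ∀ c : M, SmoothBumpFunction 𝓘(ℝ, E) c := fun c => Classical.arbitrary _
  obtain ⟨ρ, hρ⟩ := SmoothPartitionOfUnity.exists_isSubordinate 𝓘(ℝ, E) (isClosed_univ (X := M))
    (fun c => interior {x | χ c x = 1}) (fun _ => isOpen_interior) fun c _ =>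
      Set.mem_iUnion.2 ⟨c, mem_interior_iff_mem_nhds.2 (χ c).eventuallyEq_one⟩
  -- By compactness only finitely many members of the locally finite partition are nonzero, so the
  -- sum is finite.
  have hfin := ρ.locallyFinite.finite_nonempty_of_compact
  have : α = ∑ c ∈ hfin.toFinset, (fun x => ρ c x • α x : FormField E M 1) := by
    funext x
    rw [Finset.sum_apply, ← Finset.sum_smul, ρ.sum_finsupport' x (Set.mem_univ x), one_smul]
    intro c hc
    rw [Set.Finite.mem_toFinset]
    exact ⟨x, (ρ.mem_finsupport x).1 hc⟩
  rw [this]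
  exact Submodule.sum_mem _ fun c _ => smul_mem_span_mulDifferential hα (ρ c) (χ c) (hρ c)

end Decomposition

/-! ### Boundaries as brackets, and the duality. -/

namespace PoissonStructure

variable {E : Type*} [NormedAddCommGroup E] [NormedSpace ℝ E] [FiniteDimensional ℝ E]
  {M : Type*} [TopologicalSpace M] [ChartedSpace E M] [IsManifold 𝓘(ℝ, E) ∞ M]

theorem canonicalDifferential_mulDifferential (P : PoissonStructure E M) (f g : Smooth E M)
    (x : M) : P.canonicalDifferential 0 (mulDifferential f g) x ![] = P.bracket f g x :=
  contract_wedge (E := E) _ _ _ _ (exteriorD_mulDifferential f g x)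

theorem bracket_mem_boundaries (P : PoissonStructure E M) (f g : Smooth E M) :
    P.bracket f g ∈ P.boundaries :=
  ⟨mulDifferential f g, mulDifferential_mem_smoothForms f g, fun x =>
    (P.canonicalDifferential_mulDifferential f g x).symm⟩

/-- Smoothness of `α` is carried through the induction because `δ` is additive only on
differentiable forms. -/
theorem exists_mem_span_bracket (P : PoissonStructure E M) {α : FormField E M 1}
    (hα : α ∈ Submodule.span ℝ {β : FormField E M 1 | ∃ f g, β = mulDifferential f g}) :
    α ∈ smoothForms E M 1 ∧
      ∃ h ∈ Submodule.span ℝ {h : Smooth E M | ∃ f g, h = P.bracket f g},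
        ∀ x, h x = P.canonicalDifferential 0 α x ![] := by
  induction hα using Submodule.span_induction with
  | mem α h =>
    obtain ⟨f, g, rfl⟩ := h
    exact ⟨mulDifferential_mem_smoothForms f g, P.bracket f g,
      Submodule.subset_span ⟨f, g, rfl⟩, fun x =>
        (P.canonicalDifferential_mulDifferential f g x).symm⟩
  | zero =>
    refine ⟨Submodule.zero_mem _, 0, Submodule.zero_mem _, fun x => ?_⟩
    rw [← zero_smul ℝ (0 : FormField E M 1), canonicalDifferential_zero_smul]
    simp
  | add α β _ _ hα hβ =>
    obtain ⟨hα, h, hh, e⟩ := hα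
    obtain ⟨hβ, k, hk, e'⟩ := hβ
    refine ⟨Submodule.add_mem _ hα hβ, h + k, Submodule.add_mem _ hh hk, fun x => ?_⟩
    rw [canonicalDifferential_zero_add P hα hβ]
    exact congrArg₂ (· + ·) (e x) (e' x)
  | smul c α _ hα =>
    obtain ⟨hα, h, hh, e⟩ := hα
    refine ⟨Submodule.smul_mem _ c hα, c • h, Submodule.smul_mem _ c hh, fun x => ?_⟩
    rw [canonicalDifferential_zero_smul]
    exact congrArg (c * ·) (e x)

variable [T2Space M] [CompactSpace M]

theorem boundaries_eq_span_bracket (P : PoissonStructure E M) :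
    P.boundaries = Submodule.span ℝ {h : Smooth E M | ∃ f g, h = P.bracket f g} := by
  refine le_antisymm ?_ (Submodule.span_le.2 ?_)
  · rintro f ⟨α, hα, hf⟩
    obtain ⟨-, h, hh, e⟩ := P.exists_mem_span_bracket (mem_span_mulDifferential hα)
    rwa [show f = h from ContMDiffMap.ext fun x => (hf x).trans (e x).symm]
  · rintro _ ⟨f, g, rfl⟩
    exact P.bracket_mem_boundaries f g

variable (E M) in
/-- On a compact manifold every smooth function is a test function. -/
def toTestFunctions : Smooth E M →ₗ[ℝ] testFunctions E M where
  toFun f := ⟨f, HasCompactSupport.of_compactSpace f⟩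
  map_add' _ _ := rfl
  map_smul' _ _ := rfl

/-- The Casimir condition only speaks of brackets; the decomposition of `1`-forms is what extends it
to all boundaries. -/
theorem boundaries_le_ker (P : PoissonStructure E M) (Φ : P.generalizedCasimirs) :
    P.boundaries ≤ LinearMap.ker
      (((Φ : distributions E M) : testFunctions E M →ₗ[ℝ] ℝ) ∘ₗ toTestFunctions E M) := by
  rw [boundaries_eq_span_bracket, Submodule.span_le]
  rintro _ ⟨f, g, rfl⟩
  exact LinearMap.congr_fun (Φ.2 g) (toTestFunctions E M f)

/-- The functional on `H_0^can(M)` induced by a generalized Casimir function. -/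
def casimirToDual (P : PoissonStructure E M) : P.generalizedCasimirs →ₗ[ℝ] (P.H0 →L[ℝ] ℝ) where
  toFun Φ :=
    { toLinearMap := P.boundaries.liftQ _ (P.boundaries_le_ker Φ)
      cont := ((continuous_distribution (Φ : distributions E M)).comp
        (Continuous.subtype_mk continuous_id _)).quotient_lift _ }
  map_add' Φ Ψ := by
    ext y
    obtain ⟨ψ, rfl⟩ := P.boundaries.mkQ_surjective y
    rfl
  map_smul' c Φ := by
    ext y
    obtain ⟨ψ, rfl⟩ := P.boundaries.mkQ_surjective y
    rfl

/-- The generalized Casimir function given by a continuous functional on `H_0^can(M)`. -/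
def dualToCasimir (P : PoissonStructure E M) (L : P.H0 →L[ℝ] ℝ) : P.generalizedCasimirs :=
  ⟨⟨L.toLinearMap ∘ₗ P.boundaries.mkQ ∘ₗ (testFunctions E M).subtype, fun _ _ =>
    (L.continuous.comp (continuous_quot_mk.comp continuous_subtype_val)).continuousOn⟩, fun f => by
    ext ψ
    -- Only the easy inclusion is needed here: a bracket has zero class in the quotient.
    change L (P.boundaries.mkQ (P.bracket ψ f)) = 0
    rw [Submodule.mkQ_apply, (Submodule.Quotient.mk_eq_zero _).2 (P.bracket_mem_boundaries ψ f),
      map_zero]⟩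

/-- Generalized Casimir functions are the continuous functionals on `H_0^can(M)`. -/
def casimirEquivDual (P : PoissonStructure E M) : P.generalizedCasimirs ≃ₗ[ℝ] (P.H0 →L[ℝ] ℝ) where
  __ := P.casimirToDual
  invFun := P.dualToCasimir
  left_inv _ := rfl
  right_inv L := by
    ext y
    obtain ⟨ψ, rfl⟩ := P.boundaries.mkQ_surjective y
    rfl

end PoissonStructure

end PoissonCasimir

end

theorem mainTheorem9 {E : Type*} [NormedAddCommGroup E] [NormedSpace ℝ E] [FiniteDimensional ℝ E]
    {M : Type*} [TopologicalSpace M] [ChartedSpace E M] [IsManifold 𝓘(ℝ, E) ∞ M]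
    [T2Space M] [CompactSpace M] (P : PoissonCasimir.PoissonStructure E M) :
    P.boundaries =
        Submodule.span ℝ {h : PoissonCasimir.Smooth E M | ∃ f g, h = P.bracket f g} ∧
      ∃ e : P.generalizedCasimirs ≃ₗ[ℝ] (P.H0 →L[ℝ] ℝ),
        ∀ (Φ : P.generalizedCasimirs) (ψ : PoissonCasimir.testFunctions E M),
          e Φ (P.boundaries.mkQ ψ) =
            ((Φ : PoissonCasimir.distributions E M) : PoissonCasimir.testFunctions E M →ₗ[ℝ] ℝ) ψ
      :=
  ⟨P.boundaries_eq_span_bracket, P.casimirEquivDual, fun _ _ => rfl⟩
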